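/- \textbf{Model.} Let $N\ge 2$ workers be given. Let $A_t\subset\mathbb{R}^2$ be a bounded task area and let $\emptyset\ne A_i\subseteq A_t$ be the working area of worker $i$. Let $h>0$ (height of the base station), $B>0$ (bandwidth), $g>0$ (channel gain to noise ratio), $\alpha\ge 2$ (path-loss exponent), $b_i\ge 0$ (sensing cost per bit), $a_1,a_2>0$, $0<\eta<1$, $\Gamma>0$, $\kappa=\frac{1}{\eta\Gamma}$, and let $$D_i=\max_{(x_M,y_M)\in A_t,\ (x,y)\in A_i}\sqrt{(x-x_M)^2+(y-y_M)^2+h^2}$$ be the worst-case distance of worker $i$ (read as a supremum if the maximum is not attained). For a total charging power $P_c\ge 0$ and rates $\mathbf r=(r_1,\dots,r_N)\in[0,\infty)^N$, worker $i$ has the utility $$\bar u_i(r_i,\mathbf r_{-i},P_c)=\frac{r_i}{\sum_{j}r_j}P_c-\frac{2^{r_i/B}-1}{g}D_i^{\alpha}-b_ir_i ,$$ and the platform has the utility $$\bar u_m(P_c,\mathbf r)=a_1\log\Bigl(1+\sum_{i}\log(1+a_2r_i)\Bigr)-\sum_{i}\frac{r_i}{\sum_j r_j}P_cD_i^{\alpha}\kappa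 ,$$ where $\frac{r_i}{\sum_j r_j}$ is read as $0$ if $\mathbf r=0$. The Rate Determination Game (RDG) for $P_c$ is the game in which every worker $i$ chooses $r_i\ge 0$ to maximize $\bar u_i$; a Nash equilibrium is a profile $\mathbf r\in[0,\infty)^N$ in which no worker can increase its utility by changing only its own rate to another rate in $[0,\infty)$. A Stackelberg equilibrium is a pair $(\tilde P_c,\tilde{\mathbf r})$ such that $\tilde P_c\ge 0$, $\tilde{\mathbf r}$ is a Nash equilibrium of the RDG for $\tilde P_c$, and $\bar u_m(\tilde P_c,\tilde{\mathbf r})\ge\bar u_m(P_c,\mathbf r)$ for every $P_c\ge 0$ and every Nash equilibrium $\mathbf r$ of the RDG for $P_c$. \textbf{Theorem.} Fix $P_c>0$. (1) For every $i$ and every $\mathbf r_{-i}\ge 0$, the function $r_i\mapsto\bar u_i(r_i,\mathbf r_{-i},P_c)$ is strictly concave on $[0,\infty)$. If $\sum_{k\ne i}r_k>0$, worker $i$ has exactly one best response to $\mathbf r_{-i}$; if $\sum_{k\ne i}r_k=0$, it has none. (2) Let $\mathbf H(\mathbf r)$ be the $N\times N$ matrix with entries $\mathbf H_{ij}=\frac{\partial^2\bar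 u_i}{\partial r_i\partial r_j}$. At every $\mathbf r\in[0,\infty)^N$ with $\mathbf r\ne 0$ and $r_i\le\sum_{k\ne i}r_k$ for all $i$, the utilities $\bar u_i$ are twice continuously differentiable in $\mathbf r$ and $\mathbf H+\mathbf H^{\mathrm T}$ is strictly negative definite. (3) The RDG has exactly one Nash equilibrium in $[0,\infty)^N$. In it, every worker $i$ with $\bar u_i\le 0$ has $r_i=0$. Moreover, for every $P_c\ge0$ the RDG has exactly one Nash equilibrium $\mathbf r^{\mathrm{ne}}(P_c)$; the function $P_c\mapsto\bar u_m(P_c,\mathbf r^{\mathrm{ne}}(P_c))$ attains its maximum over $[0,\infty)$; and the Stackelberg equilibria are exactly the pairs $(\tilde P_c,\mathbf r^{\mathrm{ne}}(\tilde P_c))$ in which $\tilde P_c\ge 0$ is a maximizer. -/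

import Mathlib

namespace Crowdsourcing

/-- A wireless powered spatial crowdsourcing market with `N` registered workers. Locations are
points `(x, y)` of the plane. -/
structure Market (N : ℕ) where
  /-- the task area -/
  taskArea : Set (ℝ × ℝ)
  /-- the working area of each worker -/
  workArea : Fin N → Set (ℝ × ℝ)
  /-- height `h` of the mobile base station -/
  height : ℝ
  /-- channel bandwidth `B` -/
  bandwidth : ℝ
  /-- channel gain to noise ratio `g` -/
  cnr : ℝ
  /-- path-loss exponent `α` -/
  pathLoss : ℝ
  /-- sensing energy cost per bit `b i` of each worker -/
  sensingCost : Fin N → ℝ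
  /-- data utility parameter `a₁` -/
  a₁ : ℝ
  /-- data utility parameter `a₂` -/
  a₂ : ℝ
  /-- receiver energy conversion efficiency `η` -/
  efficiency : ℝ
  /-- combined antenna gain `Γ` -/
  antennaGain : ℝ
  taskArea_bounded : Bornology.IsBounded taskArea
  workArea_nonempty : ∀ i, (workArea i).Nonempty
  workArea_subset : ∀ i, workArea i ⊆ taskArea
  height_pos : 0 < height
  bandwidth_pos : 0 < bandwidth
  cnr_pos : 0 < cnr
  two_le_pathLoss : 2 ≤ pathLoss
  sensingCost_nonneg : ∀ i, 0 ≤ sensingCost i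
  a₁_pos : 0 < a₁
  a₂_pos : 0 < a₂
  efficiency_pos : 0 < efficiency
  efficiency_lt_one : efficiency < 1
  antennaGain_pos : 0 < antennaGain

namespace Market

variable {N : ℕ} (M : Market N)

/-- Distance between a worker located at `L` and the base station, which hovers at height `h`
above the point `LM`. -/
noncomputable def stationDist (L LM : ℝ × ℝ) : ℝ :=
  Real.sqrt ((L.1 - LM.1) ^ 2 + (L.2 - LM.2) ^ 2 + M.height ^ 2)

/-- The worst-case distance `D i`: the maximum of the distance over all service locations in the
task area and all working locations of worker `i` (the supremum, should it not be attained). -/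
noncomputable def maxDist (i : Fin N) : ℝ :=
  sSup {d : ℝ | ∃ LM ∈ M.taskArea, ∃ L ∈ M.workArea i, d = M.stationDist L LM}

/-- The power cost of worker `i` in the task allocation phase: worst-case transmission power for
the rate `x` plus sensing power. -/
noncomputable def powerCost (i : Fin N) (x : ℝ) : ℝ :=
  ((2 : ℝ) ^ (x / M.bandwidth) - 1) / M.cnr * M.maxDist i ^ M.pathLoss + M.sensingCost i * x

/-- The charging power that worker `i` receives out of the total supply `Pc`: proportional to its
rate. Nobody is charged if all the rates are zero (then the quotient below is `0 / 0 = 0`). -/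
noncomputable def chargingPower (Pc : ℝ) (r : Fin N → ℝ) (i : Fin N) : ℝ :=
  r i / (∑ j, r j) * Pc

/-- Utility of worker `i` in the task allocation phase. -/
noncomputable def workerUtility (Pc : ℝ) (i : Fin N) (r : Fin N → ℝ) : ℝ :=
  chargingPower Pc r i - M.powerCost i (r i)

/-- The coefficient `κ = 1 / (η Γ)`. -/
noncomputable def kappa : ℝ := 1 / (M.efficiency * M.antennaGain)

/-- Utility of the platform in the task allocation phase. -/
noncomputable def platformUtility (Pc : ℝ) (r : Fin N → ℝ) : ℝ :=
  M.a₁ * Real.log (1 + ∑ i, Real.log (1 + M.a₂ * r i))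
    - ∑ i, chargingPower Pc r i * M.maxDist i ^ M.pathLoss * M.kappa

/-- The rate `x` is a best response of worker `i` to the rates `r k`, `k ≠ i`, of the others
(the entry `r i` plays no role). -/
def IsBestResponse (Pc : ℝ) (i : Fin N) (r : Fin N → ℝ) (x : ℝ) : Prop :=
  0 ≤ x ∧ ∀ y : ℝ, 0 ≤ y →
    M.workerUtility Pc i (Function.update r i y) ≤ M.workerUtility Pc i (Function.update r i x)

/-- Nash equilibrium of the rate determination game with total charging power `Pc`. -/
def IsNashEquilibrium (Pc : ℝ) (r : Fin N → ℝ) : Prop :=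
  (∀ i, 0 ≤ r i) ∧ ∀ i, ∀ y : ℝ, 0 ≤ y →
    M.workerUtility Pc i (Function.update r i y) ≤ M.workerUtility Pc i r

/-- Stackelberg equilibrium: the workers play a Nash equilibrium for the announced supply, and the
platform cannot gain by announcing another supply, to which the workers would again respond by
a Nash equilibrium. -/
def IsStackelbergEquilibrium (Pc : ℝ) (r : Fin N → ℝ) : Prop :=
  0 ≤ Pc ∧ M.IsNashEquilibrium Pc r ∧
    ∀ (Pc' : ℝ) (r' : Fin N → ℝ), 0 ≤ Pc' → M.IsNashEquilibrium Pc' r' →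
      M.platformUtility Pc' r' ≤ M.platformUtility Pc r

/-- Partial derivative of `f` with respect to the `j`-th coordinate. -/
noncomputable def partialDeriv (j : Fin N) (f : (Fin N → ℝ) → ℝ) (r : Fin N → ℝ) : ℝ :=
  deriv (fun t => f (Function.update r j t)) (r j)

/-- The matrix function `H` with entries `∂² ū i / ∂ r i ∂ r j`. -/
noncomputable def pseudoHessian (Pc : ℝ) (r : Fin N → ℝ) : Matrix (Fin N) (Fin N) ℝ :=
  Matrix.of fun i j => partialDeriv i (partialDeriv j (M.workerUtility Pc i)) r

end Market

end Crowdsourcing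

/-!
In its own rate `t`, against a total rate `s` of the others, the utility of a worker is
`t / (t + s) * Pc` minus a strictly convex power cost. This gives strict concavity and the best
responses. The quadratic form of `-(H + Hᵀ)` is a sum of a square, a Cauchy–Schwarz defect and a
positive diagonal part from the power costs (`posDef_neg_pseudoHessian_add_transpose`).

A Nash equilibrium for `Pc > 0` is described by its total rate `R` and the shares `σ i = r i / R`.
With the marginal cost `m i`, the first-order conditions read `Pc * (1 - σ i) ≤ R * m i (R * σ i)`,
with equality where `σ i > 0` (`IsShareEquilibrium`). Given `R`, each condition determines `σ i`,
which depends continuously on `R` and does not increase with `R`. The sum of these shares is at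
least `1` for small `R`, where two or more workers each take at least one half, and vanishes for
large `R`; so it equals `1` for some `R` (`exists_isShareEquilibrium`), and monotonicity makes the
solution unique (`IsShareEquilibrium.unique_share`, `IsShareEquilibrium.unique_total`).

For the platform, the first-order conditions in `(Pc, R, σ)` are closed and remain meaningful at
`Pc = 0`, and the utility of the platform is a continuous function of `(Pc, R, σ)` although the
shares are discontinuous in the rates at `0`. For large `Pc` the logarithmic data utility is
outweighed by the linear charging cost, so that `Pc = 0` does at least as well
(`exists_forall_shareUtility_nonpos`). Hence the optimum is a maximum of a continuous function over
a compact set (`exists_isStackelbergEquilibrium`).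
-/

namespace Crowdsourcing

open Set Filter Topology

namespace Market

variable {N : ℕ} (M : Market N)

/-! ### Power costs -/

theorem height_le_stationDist (L LM : ℝ × ℝ) : M.height ≤ M.stationDist L LM := by
  refine Real.le_sqrt_of_sq_le ?_
  nlinarith [sq_nonneg (L.1 - LM.1), sq_nonneg (L.2 - LM.2)]

theorem maxDist_pos (i : Fin N) : 0 < M.maxDist i := by
  obtain ⟨L, hL⟩ := M.workArea_nonempty i
  obtain ⟨C, hC⟩ := Metric.isBounded_iff.1 M.taskArea_bounded
  have hLt := M.workArea_subset i hL
  have hbdd : BddAbove {d : ℝ | ∃ LM ∈ M.taskArea, ∃ L ∈ M.workArea i, d = M.stationDist L LM} := by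
    refine ⟨Real.sqrt (C ^ 2 + C ^ 2 + M.height ^ 2), ?_⟩
    rintro d ⟨LM, hLM, L', hL', rfl⟩
    have h := hC (M.workArea_subset i hL') hLM
    rw [Prod.dist_eq, max_le_iff, Real.dist_eq, Real.dist_eq] at h
    refine Real.sqrt_le_sqrt ?_
    have h1 := sq_le_sq' (abs_le.1 h.1).1 (abs_le.1 h.1).2
    have h2 := sq_le_sq' (abs_le.1 h.2).1 (abs_le.1 h.2).2
    linarith
  exact (M.height_pos.trans_le (M.height_le_stationDist L L)).trans_le
    (le_csSup hbdd ⟨L, hLt, L, hL, rfl⟩)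

/-- The coefficient `D i ^ α / g` of the transmission power of worker `i`. -/
noncomputable def lossCoeff (i : Fin N) : ℝ := M.maxDist i ^ M.pathLoss / M.cnr

theorem lossCoeff_pos (i : Fin N) : 0 < M.lossCoeff i :=
  div_pos (Real.rpow_pos_of_pos (M.maxDist_pos i) _) M.cnr_pos

/-- The growth rate `log 2 / B` in `2 ^ (x / B) = exp (log 2 / B * x)`. -/
noncomputable def growth : ℝ := Real.log 2 / M.bandwidth

theorem growth_pos : 0 < M.growth := div_pos (Real.log_pos one_lt_two) M.bandwidth_pos

theorem powerCost_eq (i : Fin N) (x : ℝ) :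
    M.powerCost i x = M.lossCoeff i * (Real.exp (M.growth * x) - 1) + M.sensingCost i * x := by
  have h : (2 : ℝ) ^ (x / M.bandwidth) = Real.exp (M.growth * x) := by
    rw [Real.rpow_def_of_pos two_pos, growth]
    congr 1
    ring
  rw [powerCost, h, lossCoeff]
  ring

@[simp]
theorem powerCost_zero (i : Fin N) : M.powerCost i 0 = 0 := by simp [powerCost_eq]

/-- The derivative of the power cost of worker `i`. -/
noncomputable def marginalCost (i : Fin N) (x : ℝ) : ℝ :=
  M.lossCoeff i * M.growth * Real.exp (M.growth * x) + M.sensingCost i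

theorem marginalCost_pos (i : Fin N) (x : ℝ) : 0 < M.marginalCost i x :=
  add_pos_of_pos_of_nonneg
    (mul_pos (mul_pos (M.lossCoeff_pos i) M.growth_pos) (Real.exp_pos _)) (M.sensingCost_nonneg i)

theorem marginalCost_strictMono (i : Fin N) : StrictMono (M.marginalCost i) := by
  intro x y hxy
  have := mul_pos (M.lossCoeff_pos i) M.growth_pos
  have h := Real.exp_lt_exp.2 (mul_lt_mul_of_pos_left hxy M.growth_pos)
  unfold marginalCost
  gcongr

@[fun_prop]
theorem continuous_marginalCost (i : Fin N) : Continuous (M.marginalCost i) := by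
  unfold marginalCost
  fun_prop

theorem contDiff_powerCost (i : Fin N) : ContDiff ℝ 2 (M.powerCost i) := by
  rw [funext (M.powerCost_eq i)]
  fun_prop

theorem hasDerivAt_powerCost (i : Fin N) (x : ℝ) :
    HasDerivAt (M.powerCost i) (M.marginalCost i x) x := by
  rw [funext (M.powerCost_eq i)]
  have h1 : HasDerivAt (fun x => Real.exp (M.growth * x)) (Real.exp (M.growth * x) * M.growth) x :=
    by simpa using ((hasDerivAt_id x).const_mul M.growth).exp
  refine (((h1.sub_const 1).const_mul (M.lossCoeff i)).add
    ((hasDerivAt_id x).const_mul (M.sensingCost i))).congr_deriv ?_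
  rw [marginalCost]
  ring

theorem hasDerivAt_marginalCost (i : Fin N) (x : ℝ) :
    HasDerivAt (M.marginalCost i)
      (M.lossCoeff i * M.growth ^ 2 * Real.exp (M.growth * x)) x := by
  have h1 : HasDerivAt (fun x => Real.exp (M.growth * x)) (Real.exp (M.growth * x) * M.growth) x :=
    by simpa using ((hasDerivAt_id x).const_mul M.growth).exp
  refine ((h1.const_mul (M.lossCoeff i * M.growth)).add_const (M.sensingCost i)).congr_deriv ?_
  ring

theorem strictConvexOn_powerCost (i : Fin N) : StrictConvexOn ℝ univ (M.powerCost i) := by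
  refine StrictMono.strictConvexOn_univ_of_deriv (M.contDiff_powerCost i).continuous ?_
  rw [funext fun x => (M.hasDerivAt_powerCost i x).deriv]
  exact M.marginalCost_strictMono i

theorem powerCost_tangent_le (i : Fin N) (x y : ℝ) :
    M.powerCost i x + M.marginalCost i x * (y - x) ≤ M.powerCost i y := by
  have h : Real.exp (M.growth * y) = Real.exp (M.growth * x) * Real.exp (M.growth * (y - x)) := by
    rw [← Real.exp_add]
    congr 1
    ring
  have h1 := mul_le_mul_of_nonneg_left (Real.add_one_le_exp (M.growth * (y - x)))
    (mul_pos (M.lossCoeff_pos i) (Real.exp_pos (M.growth * x))).le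
  rw [powerCost_eq, powerCost_eq, marginalCost, h]
  linarith

theorem marginalCost_zero_mul_le (i : Fin N) (x : ℝ) :
    M.marginalCost i 0 * x ≤ M.powerCost i x := by
  simpa using M.powerCost_tangent_le i 0 x

theorem powerCost_pos (i : Fin N) {x : ℝ} (hx : 0 < x) : 0 < M.powerCost i x :=
  (mul_pos (M.marginalCost_pos i 0) hx).trans_le (M.marginalCost_zero_mul_le i x)

theorem powerCost_strictMono (i : Fin N) : StrictMono (M.powerCost i) := by
  intro x y hxy
  have := mul_pos (M.marginalCost_pos i x) (sub_pos.2 hxy)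
  linarith [M.powerCost_tangent_le i x y]

/-! ### The share of a single worker -/

/-- The share of the rate `t` against the total rate `s` of the others lies below its tangents. -/
theorem share_le_tangent {s x y : ℝ} (hs : 0 < s) (hx : 0 ≤ x) (hy : 0 ≤ y) :
    y / (y + s) ≤ x / (x + s) + s / (x + s) ^ 2 * (y - x) := by
  have h1 : 0 < x + s := by linarith
  have h2 : 0 < y + s := by linarith
  have h : x / (x + s) + s / (x + s) ^ 2 * (y - x) - y / (y + s)
      = s * (y - x) ^ 2 / ((x + s) ^ 2 * (y + s)) := by
    field_simp
    ring
  have : 0 ≤ s * (y - x) ^ 2 / ((x + s) ^ 2 * (y + s)) := by positivity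
  linarith

/-- Concavity of the share includes the case `s = 0`, in which it jumps from `0 / 0 = 0` at the
end point up to `1`. -/
theorem concaveOn_share {s : ℝ} (hs : 0 ≤ s) : ConcaveOn ℝ (Ici 0) fun t : ℝ => t / (t + s) := by
  refine ⟨convex_Ici 0, fun x hx y hy a b ha hb hab => ?_⟩
  simp only [mem_Ici] at hx hy
  simp only [smul_eq_mul]
  have hz : 0 ≤ a * x + b * y := by positivity
  rcases hs.eq_or_lt with rfl | hs
  · simp only [add_zero]
    rcases hz.eq_or_lt with hz | hz
    · have hax : a * x = 0 := by nlinarith [mul_nonneg ha hx, mul_nonneg hb hy]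
      have hby : b * y = 0 := by nlinarith [mul_nonneg ha hx, mul_nonneg hb hy]
      rw [← mul_div_assoc, ← mul_div_assoc, hax, hby]
      simp
    · rw [div_self hz.ne']
      have h1 := mul_le_mul_of_nonneg_left (div_self_le_one x) ha
      have h2 := mul_le_mul_of_nonneg_left (div_self_le_one y) hb
      linarith
  · have h1 := mul_le_mul_of_nonneg_left (share_le_tangent hs hz hx) ha
    have h2 := mul_le_mul_of_nonneg_left (share_le_tangent hs hz hy) hb
    obtain rfl : b = 1 - a := by linarith
    linarith

theorem hasDerivAt_share {s t : ℝ} (h : t + s ≠ 0) :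
    HasDerivAt (fun t : ℝ => t / (t + s)) (s / (t + s) ^ 2) t := by
  refine ((hasDerivAt_id t).div ((hasDerivAt_id t).add_const s) h).congr_deriv ?_
  simp

/-- Utility of worker `i` as a function of its own rate `t`, where `s` is the total rate of the
others. -/
noncomputable def ownUtility (Pc : ℝ) (i : Fin N) (s t : ℝ) : ℝ :=
  t / (t + s) * Pc - M.powerCost i t

theorem sum_update (r : Fin N → ℝ) (i : Fin N) (t : ℝ) :
    ∑ j, Function.update r i t j = t + ∑ k ∈ Finset.univ.erase i, r k := by
  rw [← Finset.add_sum_erase _ _ (Finset.mem_univ i), Function.update_self]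
  congr 1
  exact Finset.sum_congr rfl fun k hk => Function.update_of_ne (Finset.ne_of_mem_erase hk) _ _

theorem workerUtility_update (Pc : ℝ) (i : Fin N) (r : Fin N → ℝ) (t : ℝ) :
    M.workerUtility Pc i (Function.update r i t)
      = M.ownUtility Pc i (∑ k ∈ Finset.univ.erase i, r k) t := by
  rw [workerUtility, chargingPower, ownUtility, sum_update, Function.update_self]

theorem workerUtility_eq_ownUtility (Pc : ℝ) (i : Fin N) (r : Fin N → ℝ) :
    M.workerUtility Pc i r = M.ownUtility Pc i (∑ k ∈ Finset.univ.erase i, r k) (r i) := by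
  rw [← workerUtility_update, Function.update_eq_self]

theorem strictConcaveOn_ownUtility {Pc : ℝ} (hP : 0 ≤ Pc) (i : Fin N) {s : ℝ} (hs : 0 ≤ s) :
    StrictConcaveOn ℝ (Ici 0) (M.ownUtility Pc i s) := by
  have h1 : ConcaveOn ℝ (Ici 0) fun t : ℝ => t / (t + s) * Pc := by
    simpa only [smul_eq_mul, mul_comm] using (concaveOn_share hs).smul hP
  have h2 := ((M.strictConvexOn_powerCost i).subset (subset_univ _) (convex_Ici 0)).neg
  refine (h1.add_strictConcaveOn h2).congr fun t _ => ?_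
  simp [ownUtility, sub_eq_add_neg]

theorem ownUtility_zero (Pc : ℝ) (i : Fin N) (s : ℝ) : M.ownUtility Pc i s 0 = 0 := by
  simp [ownUtility]

theorem hasDerivAt_ownUtility (Pc : ℝ) (i : Fin N) {s t : ℝ} (h : t + s ≠ 0) :
    HasDerivAt (M.ownUtility Pc i s) (s / (t + s) ^ 2 * Pc - M.marginalCost i t) t :=
  ((hasDerivAt_share h).mul_const Pc).sub (M.hasDerivAt_powerCost i t)

/-! ### Best responses -/

theorem existsUnique_isMaxOn_ownUtility {Pc : ℝ} (hP : 0 < Pc) (i : Fin N) {s : ℝ} (hs : 0 < s) :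
    ∃! x : ℝ, 0 ≤ x ∧ ∀ y : ℝ, 0 ≤ y → M.ownUtility Pc i s y ≤ M.ownUtility Pc i s x := by
  have hm := M.marginalCost_pos i 0
  have hT : 0 ≤ Pc / M.marginalCost i 0 := by positivity
  have hcont : ContinuousOn (M.ownUtility Pc i s) (Icc 0 (Pc / M.marginalCost i 0)) := by
    intro t ht
    have : t + s ≠ 0 := by linarith [ht.1]
    exact (M.hasDerivAt_ownUtility Pc i this).continuousAt.continuousWithinAt
  obtain ⟨x, hx, hmax⟩ := isCompact_Icc.exists_isMaxOn (nonempty_Icc.2 hT) hcont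
  have hxmax : IsMaxOn (M.ownUtility Pc i s) (Ici 0) x := fun y hy => by
    rw [mem_Ici] at hy
    rcases le_or_gt y (Pc / M.marginalCost i 0) with hyT | hyT
    · exact hmax ⟨hy, hyT⟩
    · -- beyond `Pc / m 0` the cost exceeds the whole supply
      have h0 : M.ownUtility Pc i s 0 ≤ M.ownUtility Pc i s x := hmax ⟨le_rfl, hT⟩
      rw [ownUtility_zero] at h0
      refine le_trans ?_ h0
      have h1 := (div_lt_iff₀ hm).1 hyT
      have h2 := M.marginalCost_zero_mul_le i y
      have h3 : y / (y + s) ≤ 1 := div_le_one_of_le₀ (by linarith) (by linarith)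
      have h4 := mul_le_mul_of_nonneg_right h3 hP.le
      rw [ownUtility]
      linarith
  exact ⟨x, ⟨hx.1, fun y hy => hxmax hy⟩, fun z ⟨hz0, hz⟩ =>
    (M.strictConcaveOn_ownUtility hP.le i hs.le).eq_of_isMaxOn (fun y hy => hz y hy) hxmax
      hz0 hx.1⟩

/-- Against silent opponents every positive rate receives the whole supply, so that a worker
always gains by halving its rate. -/
theorem not_exists_isMaxOn_ownUtility_zero {Pc : ℝ} (hP : 0 < Pc) (i : Fin N) :
    ¬ ∃ x : ℝ, 0 ≤ x ∧ ∀ y : ℝ, 0 ≤ y → M.ownUtility Pc i 0 y ≤ M.ownUtility Pc i 0 x := by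
  rintro ⟨x, hx, hmax⟩
  have hpos : ∀ y : ℝ, 0 < y → M.ownUtility Pc i 0 y = Pc - M.powerCost i y := fun y hy => by
    rw [ownUtility, add_zero, div_self hy.ne', one_mul]
  rcases hx.eq_or_lt with rfl | hx
  · have hlim : Tendsto (M.powerCost i) (𝓝[>] 0) (𝓝 0) := by
      simpa using ((M.contDiff_powerCost i).continuous.tendsto 0).mono_left
        (nhdsWithin_le_nhds (s := Ioi 0))
    obtain ⟨y, hy1, hy2⟩ := ((hlim.eventually_lt_const hP).and self_mem_nhdsWithin).exists
    have h := hmax y (le_of_lt hy2)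
    rw [hpos y hy2, ownUtility_zero] at h
    linarith
  · have h := hmax (x / 2) (by positivity)
    rw [hpos _ (half_pos hx), hpos _ hx] at h
    have := M.powerCost_strictMono i (half_lt_self hx)
    linarith

/-! ### The pseudo-Hessian -/

theorem contDiffAt_workerUtility (Pc : ℝ) (i : Fin N) {r : Fin N → ℝ} (hr : ∑ k, r k ≠ 0) :
    ContDiffAt ℝ 2 (M.workerUtility Pc i) r := by
  unfold workerUtility chargingPower
  have h1 : ContDiffAt ℝ 2 (fun r : Fin N → ℝ => ∑ k, r k) r := by fun_prop
  have h2 : ContDiffAt ℝ 2 (fun r : Fin N → ℝ => r i) r := by fun_prop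
  exact ((h2.div h1 hr).mul contDiffAt_const).sub ((M.contDiff_powerCost i).contDiffAt.comp r h2)

theorem add_sum_erase_ne {r : Fin N → ℝ} (hr : ∑ k, r k ≠ 0) (i : Fin N) :
    r i + ∑ k ∈ Finset.univ.erase i, r k ≠ 0 := by
  rwa [Finset.add_sum_erase _ _ (Finset.mem_univ i)]

theorem partialDeriv_workerUtility_self (Pc : ℝ) (i : Fin N) {r : Fin N → ℝ}
    (hr : ∑ k, r k ≠ 0) :
    partialDeriv i (M.workerUtility Pc i) r
      = (∑ k ∈ Finset.univ.erase i, r k) / (∑ k, r k) ^ 2 * Pc - M.marginalCost i (r i) := by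
  rw [partialDeriv, funext (M.workerUtility_update Pc i r),
    (M.hasDerivAt_ownUtility Pc i (add_sum_erase_ne hr i)).deriv,
    Finset.add_sum_erase _ _ (Finset.mem_univ i)]

theorem partialDeriv_workerUtility_of_ne (Pc : ℝ) {i j : Fin N} (hij : i ≠ j) {r : Fin N → ℝ}
    (hr : ∑ k, r k ≠ 0) :
    partialDeriv j (M.workerUtility Pc i) r = -r i / (∑ k, r k) ^ 2 * Pc := by
  have h : (fun t => M.workerUtility Pc i (Function.update r j t)) = fun t =>
      r i / (t + ∑ k ∈ Finset.univ.erase j, r k) * Pc - M.powerCost i (r i) := by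
    funext t
    rw [workerUtility, chargingPower, sum_update, Function.update_of_ne hij]
  have hd := ((((hasDerivAt_const (r j) (r i)).div
    ((hasDerivAt_id (r j)).add_const (∑ k ∈ Finset.univ.erase j, r k))
    (add_sum_erase_ne hr j)).mul_const Pc).sub_const (M.powerCost i (r i))).deriv
  rw [partialDeriv, h, ← Finset.add_sum_erase _ _ (Finset.mem_univ j)]
  refine hd.trans ?_
  simp

/-- Moving one coordinate a little keeps the total rate away from zero. -/
theorem eventually_sum_update_ne (i : Fin N) {r : Fin N → ℝ} (hr : ∑ k, r k ≠ 0) :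
    ∀ᶠ t in 𝓝 (r i), ∑ k, Function.update r i t k ≠ 0 := by
  simp only [sum_update]
  have hc : Continuous fun t : ℝ => t + ∑ k ∈ Finset.univ.erase i, r k := by fun_prop
  exact hc.continuousAt.eventually_ne (add_sum_erase_ne hr i)

theorem pseudoHessian_self (Pc : ℝ) (i : Fin N) {r : Fin N → ℝ} (hr : ∑ k, r k ≠ 0) :
    M.pseudoHessian Pc r i i = Pc * (2 * r i - 2 * ∑ k, r k) / (∑ k, r k) ^ 3
      - M.lossCoeff i * M.growth ^ 2 * Real.exp (M.growth * r i) := by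
  set s := ∑ k ∈ Finset.univ.erase i, r k with hs
  have hrs : r i + s ≠ 0 := add_sum_erase_ne hr i
  have h : (fun t => partialDeriv i (M.workerUtility Pc i) (Function.update r i t))
      =ᶠ[𝓝 (r i)] fun t => s / (t + s) ^ 2 * Pc - M.marginalCost i t := by
    filter_upwards [eventually_sum_update_ne i hr] with t ht
    rw [M.partialDeriv_workerUtility_self Pc i ht, sum_update, Function.update_self, ← hs]
    congr 3
    exact Finset.sum_congr rfl fun k hk => Function.update_of_ne (Finset.ne_of_mem_erase hk) _ _
  have hd := ((((hasDerivAt_const (r i) s).div (((hasDerivAt_id (r i)).add_const s).pow 2)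
    (pow_ne_zero 2 hrs)).mul_const Pc).sub (M.hasDerivAt_marginalCost i (r i))).deriv
  rw [pseudoHessian, Matrix.of_apply, partialDeriv, h.deriv_eq,
    ← Finset.add_sum_erase _ _ (Finset.mem_univ i), ← hs]
  refine hd.trans ?_
  simp only [id, Pi.pow_apply]
  field_simp
  ring

theorem pseudoHessian_of_ne (Pc : ℝ) {i j : Fin N} (hij : i ≠ j) {r : Fin N → ℝ}
    (hr : ∑ k, r k ≠ 0) :
    M.pseudoHessian Pc r i j = Pc * (2 * r i - ∑ k, r k) / (∑ k, r k) ^ 3 := by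
  set s := ∑ k ∈ Finset.univ.erase i, r k with hs
  have hrs : r i + s ≠ 0 := add_sum_erase_ne hr i
  have h : (fun t => partialDeriv j (M.workerUtility Pc i) (Function.update r i t))
      =ᶠ[𝓝 (r i)] fun t => -t / (t + s) ^ 2 * Pc := by
    filter_upwards [eventually_sum_update_ne i hr] with t ht
    rw [M.partialDeriv_workerUtility_of_ne Pc hij ht, sum_update, Function.update_self, ← hs]
  have hd := (((hasDerivAt_neg (r i)).div (((hasDerivAt_id (r i)).add_const s).pow 2)
    (pow_ne_zero 2 hrs)).mul_const Pc).deriv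
  rw [pseudoHessian, Matrix.of_apply, partialDeriv, h.deriv_eq,
    ← Finset.add_sum_erase _ _ (Finset.mem_univ i), ← hs]
  refine hd.trans ?_
  simp only [id, Pi.pow_apply]
  field_simp
  ring

theorem pseudoHessian_apply (Pc : ℝ) (i j : Fin N) {r : Fin N → ℝ} (hr : ∑ k, r k ≠ 0) :
    M.pseudoHessian Pc r i j = Pc * (2 * r i - ∑ k, r k) / (∑ k, r k) ^ 3
      - if i = j then Pc / (∑ k, r k) ^ 2
          + M.lossCoeff i * M.growth ^ 2 * Real.exp (M.growth * r i) else 0 := by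
  split_ifs with hij
  · subst hij
    rw [M.pseudoHessian_self Pc i hr]
    field_simp
    ring
  · rw [M.pseudoHessian_of_ne Pc hij hr, sub_zero]

/-- By Cauchy–Schwarz, `∑ r k * x k` is at most the total of `r` times the norm of `x`. -/
theorem sq_sum_mul_le {r : Fin N → ℝ} (hr0 : ∀ k, 0 ≤ r k) (x : Fin N → ℝ) :
    (∑ k, r k * x k) ^ 2 ≤ (∑ k, r k) ^ 2 * ∑ k, x k ^ 2 := by
  refine (Finset.sum_mul_sq_le_sq_mul_sq _ _ _).trans ?_
  refine mul_le_mul_of_nonneg_right ?_ (Finset.sum_nonneg fun k _ => sq_nonneg _)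
  exact Finset.sum_sq_le_sq_sum_of_nonneg fun k _ => hr0 k

/-- With `S = ∑ x`, `T = ∑ r x` and `R = ∑ r`, the form of `-(H + Hᵀ)` at `x` is
`2 P / R ^ 4 * ((R S - T) ^ 2 + R ^ 2 ∑ x ^ 2 - T ^ 2)` plus a positive diagonal part that comes
from the power costs. -/
theorem posDef_neg_pseudoHessian_add_transpose {Pc : ℝ} (hP : 0 < Pc) {r : Fin N → ℝ}
    (hr0 : ∀ k, 0 ≤ r k) (hr : 0 < ∑ k, r k) :
    (-(M.pseudoHessian Pc r + (M.pseudoHessian Pc r).transpose)).PosDef := by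
  refine Matrix.PosDef.of_dotProduct_mulVec_pos ?_ fun x hx => ?_
  · ext i j
    simp [add_comm]
  set R := ∑ k, r k with hR
  set e : Fin N → ℝ := fun i => M.lossCoeff i * M.growth ^ 2 * Real.exp (M.growth * r i) with he
  have hepos : ∀ i, 0 < e i := fun i =>
    mul_pos (mul_pos (M.lossCoeff_pos i) (pow_pos M.growth_pos 2)) (Real.exp_pos _)
  have hform : ∑ i, ∑ j, x i * M.pseudoHessian Pc r i j * x j
      = Pc / R ^ 3 * (2 * ∑ k, r k * x k - R * ∑ k, x k) * ∑ k, x k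
        - ∑ k, (Pc / R ^ 2 + e k) * x k ^ 2 := by
    have h1 : ∀ i, ∑ j, x i * M.pseudoHessian Pc r i j * x j
        = Pc / R ^ 3 * (2 * (r i * x i) - R * x i) * ∑ k, x k
          - (Pc / R ^ 2 + e i) * x i ^ 2 := fun i => by
      rw [Finset.mul_sum]
      have h2 : (Pc / R ^ 2 + e i) * x i ^ 2
          = ∑ j, if i = j then (Pc / R ^ 2 + e i) * x i * x j else 0 := by
        rw [Finset.sum_ite_eq Finset.univ i]
        simp
        ring
      rw [h2, ← Finset.sum_sub_distrib]
      refine Finset.sum_congr rfl fun j _ => ?_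
      rw [M.pseudoHessian_apply Pc i j hr.ne']
      split_ifs <;> ring
    rw [Finset.sum_congr rfl fun i _ => h1 i, Finset.sum_sub_distrib, ← Finset.sum_mul,
      ← Finset.mul_sum, Finset.sum_sub_distrib, ← Finset.mul_sum, ← Finset.mul_sum]
  have hquad : star x ⬝ᵥ (-(M.pseudoHessian Pc r + (M.pseudoHessian Pc r).transpose)).mulVec x
      = -2 * ∑ i, ∑ j, x i * M.pseudoHessian Pc r i j * x j := by
    have h1 : star x ⬝ᵥ (M.pseudoHessian Pc r).mulVec x
        = ∑ i, ∑ j, x i * M.pseudoHessian Pc r i j * x j := by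
      simp only [dotProduct, Matrix.mulVec, Finset.mul_sum, star_trivial, mul_assoc]
    have h2 : star x ⬝ᵥ (M.pseudoHessian Pc r).transpose.mulVec x
        = ∑ i, ∑ j, x i * M.pseudoHessian Pc r i j * x j := by
      rw [Matrix.mulVec_transpose, dotProduct_comm, ← Matrix.dotProduct_mulVec, ← h1, star_trivial]
    rw [Matrix.neg_mulVec, Matrix.add_mulVec, dotProduct_neg, dotProduct_add, h1, h2]
    ring
  obtain ⟨i, hi⟩ : ∃ i, x i ≠ 0 := Function.ne_iff.1 hx
  have hpos : 0 < ∑ k, e k * x k ^ 2 :=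
    Finset.sum_pos' (fun k _ => mul_nonneg (hepos k).le (sq_nonneg _))
      ⟨i, Finset.mem_univ i, mul_pos (hepos i) (pow_pos (abs_pos.2 hi) 2 |>.trans_eq (sq_abs _))⟩
  have hCS := sq_sum_mul_le hr0 x
  rw [← hR] at hCS
  have hsplit : ∑ k, (Pc / R ^ 2 + e k) * x k ^ 2
      = Pc / R ^ 2 * ∑ k, x k ^ 2 + ∑ k, e k * x k ^ 2 := by
    rw [Finset.mul_sum, ← Finset.sum_add_distrib]
    exact Finset.sum_congr rfl fun k _ => by ring
  rw [hquad, hform, hsplit]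
  generalize ∑ k, r k * x k = T at *
  generalize ∑ k, x k = S at *
  generalize ∑ k, x k ^ 2 = Q at *
  have hkey : 0 ≤ Pc / R ^ 4 * ((R * S - T) ^ 2 + (R ^ 2 * Q - T ^ 2)) :=
    mul_nonneg (by positivity) (add_nonneg (sq_nonneg _) (sub_nonneg.2 hCS))
  have hid : Pc / R ^ 4 * ((R * S - T) ^ 2 + (R ^ 2 * Q - T ^ 2))
      = -(Pc / R ^ 3 * (2 * T - R * S) * S) + Pc / R ^ 2 * Q := by
    field_simp
    ring
  linarith

/-! ### Nash equilibria in terms of shares -/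

/-- First-order condition for a maximum over `[0, ∞)`, as a variational inequality. -/
theorem mul_deriv_nonpos_of_isMaxOn_Ici {f : ℝ → ℝ} {f' x y : ℝ} (hx : 0 ≤ x) (hy : 0 ≤ y)
    (hf : HasDerivAt f f' x) (hmax : IsMaxOn f (Ici 0) x) : (y - x) * f' ≤ 0 := by
  have hseg : segment ℝ x y ⊆ Ici 0 := (convex_Ici 0).segment_subset hx hy
  simpa using hmax.localize.hasFDerivWithinAt_nonpos hf.hasFDerivAt.hasFDerivWithinAt
    (sub_mem_posTangentConeAt_of_segment_subset hseg)

/-- `R` is a total rate and `σ` a vector of shares (of the total rate and hence of the supply `Pc`)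
that satisfy the first-order conditions of all workers for the rates `R * σ i`, cleared of
denominators. In this form the conditions are closed, and at `Pc = 0` they force `R = 0`. -/
structure IsShareEquilibrium (Pc R : ℝ) (σ : Fin N → ℝ) : Prop where
  total_nonneg : 0 ≤ R
  share_nonneg : ∀ i, 0 ≤ σ i
  sum_share : ∑ i, σ i = 1
  le_cost : ∀ i, Pc * (1 - σ i) ≤ R * M.marginalCost i (R * σ i)
  slack : ∀ i, σ i * (R * M.marginalCost i (R * σ i) - Pc * (1 - σ i)) = 0

variable {M}

namespace IsNashEquilibrium

variable {Pc : ℝ} {r : Fin N → ℝ}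

theorem isMaxOn (h : M.IsNashEquilibrium Pc r) (i : Fin N) :
    IsMaxOn (M.ownUtility Pc i (∑ k ∈ Finset.univ.erase i, r k)) (Ici 0) (r i) := fun y hy => by
  have := h.2 i y hy
  rwa [M.workerUtility_update, M.workerUtility_eq_ownUtility] at this

theorem sum_erase_pos (hP : 0 < Pc) (h : M.IsNashEquilibrium Pc r) (i : Fin N) :
    0 < ∑ k ∈ Finset.univ.erase i, r k := by
  refine (Finset.sum_nonneg fun k _ => h.1 k).lt_of_ne fun h0 => ?_
  have hmax := h.isMaxOn i
  rw [← h0] at hmax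
  exact M.not_exists_isMaxOn_ownUtility_zero hP i ⟨r i, h.1 i, fun y hy => hmax hy⟩

/-- If the equilibrium utility is not positive, then the rate `0`, which yields `0`, is a best
response as well, and by strict concavity there is only one. -/
theorem eq_zero_of_workerUtility_nonpos (hP : 0 < Pc) (h : M.IsNashEquilibrium Pc r) {i : Fin N}
    (hu : M.workerUtility Pc i r ≤ 0) : r i = 0 := by
  rw [M.workerUtility_eq_ownUtility] at hu
  have hconc := M.strictConcaveOn_ownUtility hP.le i (h.sum_erase_pos hP i).le
  refine hconc.eq_of_isMaxOn (h.isMaxOn i) (fun y hy => ?_) (h.1 i) self_mem_Ici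
  exact (h.isMaxOn i hy).trans (hu.trans (M.ownUtility_zero Pc i _).ge)

theorem isShareEquilibrium (hN : 2 ≤ N) (hP : 0 < Pc) (h : M.IsNashEquilibrium Pc r) :
    M.IsShareEquilibrium Pc (∑ k, r k) (fun i => r i / ∑ k, r k) := by
  have hsum : ∀ i, r i + ∑ k ∈ Finset.univ.erase i, r k = ∑ k, r k := fun i =>
    Finset.add_sum_erase _ _ (Finset.mem_univ i)
  have hR : 0 < ∑ k, r k := by
    have i : Fin N := ⟨0, by omega⟩
    have := h.sum_erase_pos hP i
    linarith [h.1 i, hsum i]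
  set R := ∑ k, r k
  have hvar : ∀ i, ∀ y, 0 ≤ y →
      (y - r i) * ((R - r i) / R ^ 2 * Pc - M.marginalCost i (r i)) ≤ 0 := fun i y hy => by
    have hne : r i + ∑ k ∈ Finset.univ.erase i, r k ≠ 0 := by rw [hsum]; exact hR.ne'
    have := mul_deriv_nonpos_of_isMaxOn_Ici (h.1 i) hy (M.hasDerivAt_ownUtility Pc i hne)
      (h.isMaxOn i)
    rwa [hsum, eq_sub_of_add_eq' (hsum i)] at this
  have hid : ∀ i, R * M.marginalCost i (r i) - Pc * (1 - r i / R)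
      = -R * ((R - r i) / R ^ 2 * Pc - M.marginalCost i (r i)) := fun i => by
    field_simp
    ring
  refine ⟨hR.le, fun i => div_nonneg (h.1 i) hR.le, ?_, fun i => ?_, fun i => ?_⟩
  · rw [← Finset.sum_div, div_self hR.ne']
  · rw [mul_div_cancel₀ _ hR.ne']
    have := hvar i (r i + 1) (by linarith [h.1 i])
    nlinarith [hid i]
  · rw [mul_div_cancel₀ _ hR.ne', hid i]
    have h0 := hvar i 0 le_rfl
    have h2 := hvar i (2 * r i) (by linarith [h.1 i])
    have : r i * ((R - r i) / R ^ 2 * Pc - M.marginalCost i (r i)) = 0 := by linarith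
    rw [div_mul_eq_mul_div, ← mul_assoc, mul_comm (r i), mul_assoc, this]
    simp

end IsNashEquilibrium

theorem isNashEquilibrium_zero_iff {r : Fin N → ℝ} : M.IsNashEquilibrium 0 r ↔ r = 0 := by
  have hown : ∀ i s t, M.ownUtility 0 i s t = -M.powerCost i t := fun i s t => by
    simp [ownUtility]
  constructor
  · refine fun h => funext fun i => ?_
    by_contra hne
    have h0 := h.2 i 0 le_rfl
    rw [M.workerUtility_update, M.workerUtility_eq_ownUtility, hown, hown, powerCost_zero] at h0
    have := M.powerCost_pos i ((h.1 i).lt_of_ne' hne)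
    linarith
  · rintro rfl
    refine ⟨fun i => le_rfl, fun i y hy => ?_⟩
    rw [M.workerUtility_update, M.workerUtility_eq_ownUtility, hown, hown]
    exact neg_le_neg ((M.powerCost_strictMono i).monotone hy)

namespace IsShareEquilibrium

variable {Pc R : ℝ} {σ : Fin N → ℝ}

theorem share_le_one (h : M.IsShareEquilibrium Pc R σ) (i : Fin N) : σ i ≤ 1 :=
  h.sum_share ▸ Finset.single_le_sum (fun k _ => h.share_nonneg k) (Finset.mem_univ i)

theorem exists_share_lt_one (hN : 2 ≤ N) (h : M.IsShareEquilibrium Pc R σ) : ∃ i, σ i < 1 := by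
  by_contra! hge
  have h1 : ∑ _i : Fin N, (1 : ℝ) ≤ ∑ i, σ i := Finset.sum_le_sum fun i _ => hge i
  rw [h.sum_share] at h1
  have : (2 : ℝ) ≤ N := by exact_mod_cast hN
  simp at h1
  linarith

theorem exists_share_pos (h : M.IsShareEquilibrium Pc R σ) : ∃ i, 0 < σ i := by
  by_contra! hle
  have := Finset.sum_nonpos fun i (_ : i ∈ Finset.univ) => hle i
  linarith [h.sum_share]

theorem cost_eq (h : M.IsShareEquilibrium Pc R σ) {i : Fin N} (hi : 0 < σ i) :
    R * M.marginalCost i (R * σ i) = Pc * (1 - σ i) := by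
  have := (mul_eq_zero.1 (h.slack i)).resolve_left hi.ne'
  linarith

theorem total_pos (hN : 2 ≤ N) (hP : 0 < Pc) (h : M.IsShareEquilibrium Pc R σ) : 0 < R := by
  obtain ⟨i, hi⟩ := h.exists_share_lt_one hN
  refine h.total_nonneg.lt_of_ne fun h0 => ?_
  have h1 := h.le_cost i
  rw [← h0, zero_mul] at h1
  linarith [mul_pos hP (sub_pos.2 hi)]

theorem total_eq_zero (h : M.IsShareEquilibrium 0 R σ) : R = 0 := by
  obtain ⟨i, hi⟩ := h.exists_share_pos
  have h1 := h.cost_eq hi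
  rw [zero_mul] at h1
  exact (mul_eq_zero.1 h1).resolve_right (M.marginalCost_pos i _).ne'

/-- A worker with a positive rate pays at least its marginal cost at `0`, which bounds the total
rate linearly in the supply. -/
theorem exists_total_mul_le (hP : 0 ≤ Pc) (h : M.IsShareEquilibrium Pc R σ) :
    ∃ i, R * M.marginalCost i 0 ≤ Pc := by
  obtain ⟨i, hi⟩ := h.exists_share_pos
  refine ⟨i, ?_⟩
  have h1 := (M.marginalCost_strictMono i).monotone (mul_nonneg h.total_nonneg hi.le)
  have h2 := mul_le_mul_of_nonneg_left h1 h.total_nonneg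
  rw [h.cost_eq hi] at h2
  nlinarith

theorem isNashEquilibrium (hN : 2 ≤ N) (hP : 0 < Pc) (h : M.IsShareEquilibrium Pc R σ) :
    M.IsNashEquilibrium Pc (fun i => R * σ i) := by
  have hR := h.total_pos hN hP
  refine ⟨fun i => mul_nonneg h.total_nonneg (h.share_nonneg i), fun i y hy => ?_⟩
  rw [M.workerUtility_update, M.workerUtility_eq_ownUtility]
  have hsum : R * σ i + ∑ k ∈ Finset.univ.erase i, R * σ k = R := by
    rw [Finset.add_sum_erase _ (fun k => R * σ k) (Finset.mem_univ i), ← Finset.mul_sum,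
      h.sum_share, mul_one]
  have hs : ∑ k ∈ Finset.univ.erase i, R * σ k = R * (1 - σ i) := by linarith
  rw [hs]
  -- nobody holds the whole share, since the marginal cost is positive
  have hlt : σ i < 1 := by
    refine (h.share_le_one i).lt_of_ne fun h1 => ?_
    have h2 := h.cost_eq (i := i) (by linarith)
    rw [h1, sub_self, mul_zero] at h2
    exact (mul_pos hR (M.marginalCost_pos i _)).ne' h2
  have hx : 0 ≤ R * σ i := mul_nonneg hR.le (h.share_nonneg i)
  have h1 := mul_le_mul_of_nonneg_right
    (share_le_tangent (mul_pos hR (sub_pos.2 hlt)) hx hy) hP.le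
  have h2 := M.powerCost_tangent_le i (R * σ i) y
  have hden : R * σ i + R * (1 - σ i) = R := by ring
  rw [ownUtility, ownUtility]
  rw [hden] at h1 ⊢
  have h3 : R * (1 - σ i) / R ^ 2 * (y - R * σ i) * Pc - M.marginalCost i (R * σ i) * (y - R * σ i)
      = (y * (Pc * (1 - σ i) - R * M.marginalCost i (R * σ i))
        + R * (σ i * (R * M.marginalCost i (R * σ i) - Pc * (1 - σ i)))) / R := by
    field_simp
    ring
  rw [h.slack i, mul_zero, add_zero] at h3
  have h4 : y * (Pc * (1 - σ i) - R * M.marginalCost i (R * σ i)) / R ≤ 0 :=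
    div_nonpos_of_nonpos_of_nonneg
      (mul_nonpos_of_nonneg_of_nonpos hy (sub_nonpos.2 (h.le_cost i))) hR.le
  linarith

/-- A larger total rate means smaller shares. -/
theorem share_antitone (hP : 0 < Pc) {R' : ℝ} {σ' : Fin N → ℝ}
    (h : M.IsShareEquilibrium Pc R σ) (h' : M.IsShareEquilibrium Pc R' σ') (hRR : R ≤ R')
    (i : Fin N) : σ' i ≤ σ i := by
  by_contra! hlt
  have hpos : 0 < σ' i := (h.share_nonneg i).trans_lt hlt
  have h1 : R * σ i ≤ R' * σ' i := mul_le_mul hRR hlt.le (h.share_nonneg i) h'.total_nonneg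
  have h2 : R * M.marginalCost i (R * σ i) ≤ R' * M.marginalCost i (R' * σ' i) :=
    mul_le_mul hRR ((M.marginalCost_strictMono i).monotone h1) (M.marginalCost_pos i _).le
      h'.total_nonneg
  have h3 := h'.cost_eq hpos
  have h4 := h.le_cost i
  nlinarith

theorem unique_share (hP : 0 < Pc) {R' : ℝ} {σ' : Fin N → ℝ}
    (h : M.IsShareEquilibrium Pc R σ) (h' : M.IsShareEquilibrium Pc R' σ') : σ = σ' := by
  wlog hRR : R ≤ R' generalizing R R' σ σ'
  · exact (this h' h (le_of_not_ge hRR)).symm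
  have hle := share_antitone hP h h' hRR
  have heq := (Finset.sum_eq_sum_iff_of_le fun i _ => hle i).1 (h'.sum_share.trans h.sum_share.symm)
  exact funext fun i => (heq i (Finset.mem_univ i)).symm

theorem unique_total (hN : 2 ≤ N) (hP : 0 < Pc) {R' : ℝ} {σ' : Fin N → ℝ}
    (h : M.IsShareEquilibrium Pc R σ) (h' : M.IsShareEquilibrium Pc R' σ') : R = R' := by
  obtain rfl := unique_share hP h h'
  obtain ⟨i, hi⟩ := h.exists_share_pos
  have hmono : ∀ {A B : ℝ}, 0 < A → A < B →
      A * M.marginalCost i (A * σ i) < B * M.marginalCost i (B * σ i) := fun hA hAB =>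
    mul_lt_mul hAB ((M.marginalCost_strictMono i).monotone
      (mul_le_mul_of_nonneg_right hAB.le hi.le)) (M.marginalCost_pos i _) (hA.trans hAB).le
  have h1 := (h.cost_eq hi).trans (h'.cost_eq hi).symm
  rcases lt_trichotomy R R' with hlt | heq | hlt
  · exact absurd h1 (hmono (h.total_pos hN hP) hlt).ne
  · exact heq
  · exact absurd h1 (hmono (h'.total_pos hN hP) hlt).ne'

end IsShareEquilibrium

/-! ### Existence of the equilibrium -/

variable (M)

/-- For a fixed total rate, the first-order condition of a worker determines its share, provided
that negative shares are admitted. -/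
theorem exists_share_root {Pc R : ℝ} (hP : 0 < Pc) (hR : 0 < R) (i : Fin N) :
    ∃ x : ℝ, Pc * (1 - x) - R * M.marginalCost i (R * x) = 0 := by
  set F : ℝ → ℝ := fun x => Pc * (1 - x) - R * M.marginalCost i (R * x)
  have hF : Continuous F := by fun_prop
  set a := 1 - R * M.marginalCost i R / Pc
  have ha : a ≤ 1 := sub_le_self _
    (div_nonneg (mul_pos hR (M.marginalCost_pos i R)).le hP.le)
  have h1 : F 1 ≤ 0 := by
    have := mul_pos hR (M.marginalCost_pos i (R * 1))
    simp only [F]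
    linarith
  have h2 : 0 ≤ F a := by
    have h3 : Pc * (1 - a) = R * M.marginalCost i R := by
      simp only [a]
      field_simp
      ring
    have h4 : M.marginalCost i (R * a) ≤ M.marginalCost i R :=
      (M.marginalCost_strictMono i).monotone (mul_le_of_le_one_right hR.le ha)
    simp only [F]
    rw [h3]
    exact sub_nonneg.2 (mul_le_mul_of_nonneg_left h4 hR.le)
  obtain ⟨x, -, hx⟩ := intermediate_value_Icc' ha hF.continuousOn ⟨h1, h2⟩
  exact ⟨x, hx⟩

/-- The marginal gain from a larger share decreases with the share. -/
theorem shareGain_strictAnti {Pc R : ℝ} (hP : 0 < Pc) (hR : 0 < R) (i : Fin N) :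
    StrictAnti fun x : ℝ => Pc * (1 - x) - R * M.marginalCost i (R * x) := by
  intro x y hxy
  have h1 := mul_lt_mul_of_pos_left hxy hP
  have h2 := mul_lt_mul_of_pos_left
    (M.marginalCost_strictMono i (mul_lt_mul_of_pos_left hxy hR)) hR
  simp only
  linarith

/-- The root of a function that is strictly decreasing in the unknown depends continuously on a
parameter. -/
theorem continuousOn_of_strictAnti_root {F : ℝ → ℝ → ℝ} {s : Set ℝ} {ρ : ℝ → ℝ}
    (hF : ∀ x, Continuous fun p => F p x) (hanti : ∀ p ∈ s, StrictAnti (F p))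
    (hρ : ∀ p ∈ s, F p (ρ p) = 0) : ContinuousOn ρ s := by
  intro p hp
  refine tendsto_order.2 ⟨fun a ha => ?_, fun b hb => ?_⟩
  · have h0 : 0 < F p a := hρ p hp ▸ hanti p hp ha
    have hev := ((hF a).continuousWithinAt (s := s) (x := p)).eventually_const_lt h0
    filter_upwards [hev, self_mem_nhdsWithin] with q hq hqs
    rw [← hρ q hqs] at hq
    exact (hanti q hqs).lt_iff_gt.1 hq
  · have h0 : F p b < 0 := hρ p hp ▸ hanti p hp hb
    have hev := ((hF b).continuousWithinAt (s := s) (x := p)).eventually_lt_const h0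
    filter_upwards [hev, self_mem_nhdsWithin] with q hq hqs
    rw [← hρ q hqs] at hq
    exact (hanti q hqs).lt_iff_gt.1 hq

theorem exists_isShareEquilibrium (hN : 2 ≤ N) {Pc : ℝ} (hP : 0 < Pc) :
    ∃ R σ, M.IsShareEquilibrium Pc R σ := by
  choose! ρ hρ using fun (i : Fin N) (R : ℝ) (hR : 0 < R) => M.exists_share_root hP hR i
  have hcont : ∀ i, ContinuousOn (ρ i) (Ioi 0) := fun i =>
    continuousOn_of_strictAnti_root
      (F := fun R x => Pc * (1 - x) - R * M.marginalCost i (R * x))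
      (fun x => by fun_prop) (fun R hR => M.shareGain_strictAnti hP hR i) (hρ i)
  -- the marginal costs on `[0, 1]` lie between `c` and `C`
  obtain ⟨C, hC⟩ : ∃ C, ∀ i, M.marginalCost i 1 ≤ C :=
    (Set.finite_range fun i => M.marginalCost i 1).bddAbove.imp fun C hC i => hC ⟨i, rfl⟩
  have i₀ : Fin N := ⟨0, by omega⟩
  have : Nonempty (Fin N) := ⟨i₀⟩
  obtain ⟨i₁, hi₁⟩ := Finite.exists_min fun i => M.marginalCost i 0
  set c := M.marginalCost i₁ 0
  have hc : 0 < c := M.marginalCost_pos i₁ 0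
  have hCpos : 0 < C := (M.marginalCost_pos i₀ 1).trans_le (hC i₀)
  set A := min 1 (Pc / (2 * C))
  set B := max 1 (Pc / c)
  have hA : 0 < A := lt_min one_pos (by positivity)
  have hAB : A ≤ B := (min_le_left _ _).trans (le_max_left _ _)
  set Φ : ℝ → ℝ := fun R => ∑ i, max 0 (ρ i R)
  have hΦ : ContinuousOn Φ (Icc A B) := by
    refine continuousOn_finsetSum _ fun i _ => ?_
    refine (continuousOn_const.sup (hcont i)).mono fun R hR => hA.trans_le hR.1
  -- a small total rate leaves every worker a share of at least one half
  have hΦA : 1 ≤ Φ A := by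
    have hhalf : ∀ i, (1 / 2 : ℝ) ≤ max 0 (ρ i A) := fun i => by
      refine le_max_of_le_right ?_
      by_contra! hlt
      have h1 := M.shareGain_strictAnti hP hA i hlt
      simp only [hρ i A hA] at h1
      have h2 : M.marginalCost i (A * (1 / 2)) ≤ C :=
        ((M.marginalCost_strictMono i).monotone (by
          have : A ≤ 1 := min_le_left _ _
          linarith)).trans (hC i)
      have h3 : A * (2 * C) ≤ Pc := (le_div_iff₀ (by positivity)).1 (min_le_right _ _)
      have h4 := mul_le_mul_of_nonneg_left h2 hA.le
      linarith
    have h1 : ∑ _i : Fin N, (1 / 2 : ℝ) ≤ Φ A := Finset.sum_le_sum fun i _ => hhalf i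
    have h2 : (2 : ℝ) ≤ N := by exact_mod_cast hN
    simp at h1
    linarith
  -- a large total rate drives every worker out
  have hΦB : Φ B ≤ 1 := by
    refine le_trans (Finset.sum_nonpos fun i _ => max_le le_rfl ?_) zero_le_one
    by_contra! hlt
    have hB : 0 < B := hA.trans_le hAB
    have h1 := M.shareGain_strictAnti hP hB i hlt
    simp only [hρ i B hB, mul_zero] at h1
    have h2 : Pc ≤ B * c := (div_le_iff₀ hc).1 (le_max_right _ _)
    have h3 := mul_le_mul_of_nonneg_left (hi₁ i) hB.le
    linarith
  obtain ⟨R, hR, hΦR⟩ := intermediate_value_Icc' hAB hΦ ⟨hΦB, hΦA⟩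
  have hR0 : 0 < R := hA.trans_le hR.1
  refine ⟨R, fun i => max 0 (ρ i R), hR0.le, fun i => le_max_left _ _, hΦR, fun i => ?_,
    fun i => ?_⟩
  · have h1 := (M.shareGain_strictAnti hP hR0 i).antitone (le_max_right 0 (ρ i R))
    simp only [hρ i R hR0] at h1
    linarith
  · rcases le_total (ρ i R) 0 with h0 | h0
    · rw [max_eq_left h0, zero_mul]
    · rw [max_eq_right h0, ← neg_sub, hρ i R hR0]
      simp

theorem existsUnique_isNashEquilibrium (hN : 2 ≤ N) {Pc : ℝ} (hP : 0 ≤ Pc) :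
    ∃! r : Fin N → ℝ, M.IsNashEquilibrium Pc r := by
  rcases hP.eq_or_lt with rfl | hP
  · simp only [isNashEquilibrium_zero_iff]
    exact existsUnique_eq
  · obtain ⟨R, σ, h⟩ := M.exists_isShareEquilibrium hN hP
    refine ⟨_, h.isNashEquilibrium hN hP, fun r hr => funext fun i => ?_⟩
    have h' := hr.isShareEquilibrium hN hP
    have hR := h'.total_pos hN hP
    rw [← h'.unique_total hN hP h, ← h'.unique_share hP h, mul_div_cancel₀ _ hR.ne']

/-! ### The platform -/

theorem lossFactor_pos (i : Fin N) : 0 < M.maxDist i ^ M.pathLoss * M.kappa :=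
  mul_pos (Real.rpow_pos_of_pos (M.maxDist_pos i) _)
    (one_div_pos.2 (mul_pos M.efficiency_pos M.antennaGain_pos))

/-- Utility of the platform as a function of the supply, the total rate and the shares. Unlike
`platformUtility`, in which the shares are quotients, it is continuous at the rate vector `0`. -/
noncomputable def shareUtility (Pc R : ℝ) (σ : Fin N → ℝ) : ℝ :=
  M.a₁ * Real.log (1 + ∑ i, Real.log (1 + M.a₂ * (R * σ i)))
    - ∑ i, σ i * Pc * (M.maxDist i ^ M.pathLoss * M.kappa)

theorem uniform_isShareEquilibrium_zero (hN : 2 ≤ N) :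
    M.IsShareEquilibrium 0 0 fun _ => (N : ℝ)⁻¹ where
  total_nonneg := le_rfl
  share_nonneg _ := by positivity
  sum_share := by
    have : (N : ℝ) ≠ 0 := by positivity
    simp [this]
  le_cost _ := by simp
  slack _ := by simp

variable {M} in
theorem IsNashEquilibrium.exists_isShareEquilibrium (hN : 2 ≤ N) {Pc : ℝ} (hP : 0 ≤ Pc)
    {r : Fin N → ℝ} (h : M.IsNashEquilibrium Pc r) :
    ∃ R σ, M.IsShareEquilibrium Pc R σ ∧ r = fun i => R * σ i := by
  rcases hP.eq_or_lt with rfl | hP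
  · refine ⟨0, _, M.uniform_isShareEquilibrium_zero hN, ?_⟩
    rw [isNashEquilibrium_zero_iff.1 h]
    simp [Pi.zero_def]
  · have h' := h.isShareEquilibrium hN hP
    exact ⟨_, _, h', funext fun i => (mul_div_cancel₀ _ (h'.total_pos hN hP).ne').symm⟩

namespace IsShareEquilibrium

variable {M} {Pc R : ℝ} {σ : Fin N → ℝ}

theorem isNashEquilibrium_of_nonneg (hN : 2 ≤ N) (hP : 0 ≤ Pc) (h : M.IsShareEquilibrium Pc R σ) :
    M.IsNashEquilibrium Pc (fun i => R * σ i) := by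
  rcases hP.eq_or_lt with rfl | hP
  · rw [isNashEquilibrium_zero_iff, h.total_eq_zero]
    simp [Pi.zero_def]
  · exact h.isNashEquilibrium hN hP

theorem platformUtility_eq (hN : 2 ≤ N) (hP : 0 ≤ Pc) (h : M.IsShareEquilibrium Pc R σ) :
    M.platformUtility Pc (fun i => R * σ i) = M.shareUtility Pc R σ := by
  have hch : ∀ i, chargingPower Pc (fun i => R * σ i) i = σ i * Pc := fun i => by
    rcases hP.eq_or_lt with rfl | hP
    · simp [chargingPower]
    · rw [chargingPower, ← Finset.mul_sum, h.sum_share, mul_one,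
        mul_div_cancel_left₀ _ (h.total_pos hN hP).ne']
  simp only [platformUtility, shareUtility, hch, mul_assoc]

end IsShareEquilibrium

theorem exists_forall_total_mul_le (hN : 2 ≤ N) :
    ∃ c > 0, ∀ {Pc R : ℝ} {σ : Fin N → ℝ}, 0 ≤ Pc → M.IsShareEquilibrium Pc R σ →
      R * c ≤ Pc := by
  have : Nonempty (Fin N) := ⟨⟨0, by omega⟩⟩
  obtain ⟨i₁, hi₁⟩ := Finite.exists_min fun i => M.marginalCost i 0
  refine ⟨M.marginalCost i₁ 0, M.marginalCost_pos i₁ 0, fun hP h => ?_⟩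
  obtain ⟨i, hi⟩ := h.exists_total_mul_le hP
  exact (mul_le_mul_of_nonneg_left (hi₁ i) h.total_nonneg).trans hi

/-- The data utility grows at most like `log Pc`, whereas the charging cost grows linearly. -/
theorem exists_forall_shareUtility_nonpos (hN : 2 ≤ N) :
    ∃ P₁ : ℝ, 0 ≤ P₁ ∧ ∀ {Pc R : ℝ} {σ : Fin N → ℝ}, P₁ ≤ Pc → M.IsShareEquilibrium Pc R σ →
      M.shareUtility Pc R σ ≤ 0 := by
  obtain ⟨c, hc, hle⟩ := M.exists_forall_total_mul_le hN
  have : Nonempty (Fin N) := ⟨⟨0, by omega⟩⟩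
  obtain ⟨i₀, hi₀⟩ := Finite.exists_min fun i => M.maxDist i ^ M.pathLoss * M.kappa
  set d := M.maxDist i₀ ^ M.pathLoss * M.kappa
  have hd : 0 < d := M.lossFactor_pos i₀
  have ha₁ := M.a₁_pos
  have ha₂ := M.a₂_pos
  have hNpos : (0 : ℝ) < N := by exact_mod_cast (by omega : 0 < N)
  set b := M.a₂ / c
  have hb : 0 < b := div_pos ha₂ hc
  set ε := d / (2 * b * (M.a₁ * N))
  have hε : 0 < ε := by positivity
  obtain ⟨X, hX⟩ := eventually_atTop.1 (Real.isLittleO_log_id_atTop.def hε)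
  refine ⟨max (1 / b) (X / b), le_max_of_le_left (by positivity), fun {Pc R σ} hP h => ?_⟩
  have hP1 : 1 ≤ b * Pc := by
    have := (div_le_iff₀ hb).1 ((le_max_left _ _).trans hP)
    linarith
  have hPX : X ≤ b * Pc := by
    have := (div_le_iff₀ hb).1 ((le_max_right _ _).trans hP)
    linarith
  have hP0 : 0 ≤ Pc := by
    by_contra! hneg
    linarith [mul_neg_of_pos_of_neg hb hneg]
  have hR := h.total_nonneg
  have hRb : M.a₂ * R ≤ b * Pc := by
    have h1 := mul_le_mul_of_nonneg_left (hle hP0 h) hb.le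
    have h2 : b * (R * c) = M.a₂ * R := by
      simp only [b]
      field_simp
    linarith
  have hterm : ∀ i, 0 ≤ M.a₂ * (R * σ i) ∧ M.a₂ * (R * σ i) ≤ b * Pc := fun i =>
    ⟨mul_nonneg ha₂.le (mul_nonneg hR (h.share_nonneg i)),
      (mul_le_mul_of_nonneg_left (mul_le_of_le_one_right hR (h.share_le_one i)) ha₂.le).trans hRb⟩
  have hlog : Real.log (1 + b * Pc) ≤ ε * (2 * (b * Pc)) := by
    have h1 := hX (1 + b * Pc) (by linarith)
    rw [Real.norm_eq_abs, id, Real.norm_eq_abs, abs_of_pos (a := 1 + b * Pc) (by linarith)] at h1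
    exact (le_abs_self _).trans (h1.trans (mul_le_mul_of_nonneg_left (by linarith) hε.le))
  have hsum0 : 0 ≤ ∑ i, Real.log (1 + M.a₂ * (R * σ i)) :=
    Finset.sum_nonneg fun i _ => Real.log_nonneg (by linarith [(hterm i).1])
  have hsum : ∑ i, Real.log (1 + M.a₂ * (R * σ i)) ≤ N * (ε * (2 * (b * Pc))) := by
    have h1 := Finset.sum_le_card_nsmul Finset.univ
      (fun i => Real.log (1 + M.a₂ * (R * σ i))) (ε * (2 * (b * Pc))) fun i _ =>
        (Real.log_le_log (by linarith [(hterm i).1]) (by linarith [(hterm i).2])).trans hlog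
    simpa using h1
  have houter : Real.log (1 + ∑ i, Real.log (1 + M.a₂ * (R * σ i)))
      ≤ N * (ε * (2 * (b * Pc))) := by
    have := Real.log_le_sub_one_of_pos
      (x := 1 + ∑ i, Real.log (1 + M.a₂ * (R * σ i))) (by linarith)
    linarith
  have hcost : Pc * d ≤ ∑ i, σ i * Pc * (M.maxDist i ^ M.pathLoss * M.kappa) := by
    have h1 : ∑ i, σ i * Pc * d = Pc * d := by
      rw [← Finset.sum_mul, ← Finset.sum_mul, h.sum_share, one_mul]
    rw [← h1]
    exact Finset.sum_le_sum fun i _ =>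
      mul_le_mul_of_nonneg_left (hi₀ i) (mul_nonneg (h.share_nonneg i) hP0)
  have hval : M.a₁ * (N * (ε * (2 * (b * Pc)))) = Pc * d := by
    simp only [ε]
    field_simp
  have := mul_le_mul_of_nonneg_left houter ha₁.le
  rw [shareUtility]
  linarith

theorem isClosed_isShareEquilibrium :
    IsClosed {p : ℝ × ℝ × (Fin N → ℝ) | M.IsShareEquilibrium p.1 p.2.1 p.2.2} := by
  have h : {p : ℝ × ℝ × (Fin N → ℝ) | M.IsShareEquilibrium p.1 p.2.1 p.2.2}
      = {p | 0 ≤ p.2.1} ∩ (⋂ i, {p | 0 ≤ p.2.2 i}) ∩ {p | ∑ i, p.2.2 i = 1}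
        ∩ (⋂ i, {p | p.1 * (1 - p.2.2 i) ≤ p.2.1 * M.marginalCost i (p.2.1 * p.2.2 i)})
        ∩ ⋂ i, {p | p.2.2 i * (p.2.1 * M.marginalCost i (p.2.1 * p.2.2 i)
            - p.1 * (1 - p.2.2 i)) = 0} := by
    ext p
    simp only [mem_inter_iff, mem_iInter]
    exact ⟨fun h => ⟨⟨⟨⟨h.1, h.2⟩, h.3⟩, h.4⟩, h.5⟩, fun h => ⟨h.1.1.1.1, h.1.1.1.2, h.1.1.2,
      h.1.2, h.2⟩⟩
  rw [h]
  refine (((IsClosed.inter ?_ (isClosed_iInter fun i => ?_)).inter ?_).inter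
    (isClosed_iInter fun i => ?_)).inter (isClosed_iInter fun i => ?_)
  · exact isClosed_le continuous_const (by fun_prop)
  · exact isClosed_le continuous_const (by fun_prop)
  · exact isClosed_eq (by fun_prop) continuous_const
  · exact isClosed_le (by fun_prop) (by fun_prop)
  · exact isClosed_eq (by fun_prop) continuous_const

theorem continuousOn_shareUtility :
    ContinuousOn (fun p : ℝ × ℝ × (Fin N → ℝ) => M.shareUtility p.1 p.2.1 p.2.2)
      {p | M.IsShareEquilibrium p.1 p.2.1 p.2.2} := by
  have harg : ∀ p ∈ {p : ℝ × ℝ × (Fin N → ℝ) | M.IsShareEquilibrium p.1 p.2.1 p.2.2}, ∀ i,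
      1 ≤ 1 + M.a₂ * (p.2.1 * p.2.2 i) := fun p hp i =>
    le_add_of_nonneg_right (mul_nonneg M.a₂_pos.le (mul_nonneg hp.total_nonneg (hp.share_nonneg i)))
  unfold shareUtility
  refine (continuousOn_const.mul (ContinuousOn.log (continuousOn_const.add
    (continuousOn_finsetSum _ fun i _ => ContinuousOn.log (by fun_prop) fun p hp => ?_))
    fun p hp => ?_)).sub (by fun_prop)
  · linarith [harg p hp i]
  · have := Finset.sum_nonneg fun i (_ : i ∈ Finset.univ) => Real.log_nonneg (harg p hp i)
    exact (add_pos_of_pos_of_nonneg one_pos this).ne'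

theorem exists_isStackelbergEquilibrium (hN : 2 ≤ N) :
    ∃ Pc r, M.IsStackelbergEquilibrium Pc r := by
  obtain ⟨c, hc, hle⟩ := M.exists_forall_total_mul_le hN
  obtain ⟨P₁, hP₁, hneg⟩ := M.exists_forall_shareUtility_nonpos hN
  set K : Set (ℝ × ℝ × (Fin N → ℝ)) :=
    {p | M.IsShareEquilibrium p.1 p.2.1 p.2.2} ∩ {p | p.1 ∈ Icc 0 P₁}
  have hK : IsCompact K := by
    refine (isCompact_Icc (a := ((0 : ℝ), (0 : ℝ), (0 : Fin N → ℝ)))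
      (b := (P₁, P₁ / c, 1))).of_isClosed_subset ?_ ?_
    · exact M.isClosed_isShareEquilibrium.inter (isClosed_Icc.preimage continuous_fst)
    · rintro ⟨P, R, σ⟩ ⟨h, h0, h1⟩
      exact ⟨⟨h0, h.total_nonneg, h.share_nonneg⟩,
        h1, (le_div_iff₀ hc).2 ((hle h0 h).trans h1), h.share_le_one⟩
  have hzero : ((0 : ℝ), (0 : ℝ), fun _ : Fin N => (N : ℝ)⁻¹) ∈ K :=
    ⟨M.uniform_isShareEquilibrium_zero hN, le_rfl, hP₁⟩
  obtain ⟨⟨P, R, σ⟩, ⟨h, hP⟩, hmax⟩ := hK.exists_isMaxOn ⟨_, hzero⟩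
    (M.continuousOn_shareUtility.mono inter_subset_left)
  have h0 : 0 ≤ M.shareUtility P R σ := by
    simpa [shareUtility] using hmax hzero
  refine ⟨P, _, hP.1, h.isNashEquilibrium_of_nonneg hN hP.1, fun P' r' hP' hr' => ?_⟩
  obtain ⟨R', σ', h', rfl⟩ := hr'.exists_isShareEquilibrium hN hP'
  rw [h.platformUtility_eq hN hP.1, h'.platformUtility_eq hN hP']
  rcases le_total P' P₁ with hPP | hPP
  · exact hmax (a := (P', R', σ')) ⟨h', hP', hPP⟩
  · exact (hneg hPP h').trans h0

end Market

end Crowdsourcing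

theorem mainTheorem1 {N : ℕ} (hN : 2 ≤ N) (M : Crowdsourcing.Market N) :
    -- the rate determination game for a fixed total charging power
    (∀ Pc : ℝ, 0 < Pc →
      -- strict concavity of each utility in the worker's own rate
      (∀ (i : Fin N) (r : Fin N → ℝ), (∀ k, 0 ≤ r k) →
        StrictConcaveOn ℝ (Set.Ici 0)
          (fun t : ℝ => M.workerUtility Pc i (Function.update r i t))) ∧
      -- best responses
      (∀ (i : Fin N) (r : Fin N → ℝ), (∀ k, 0 ≤ r k) →
        (0 < ∑ k ∈ Finset.univ.erase i, r k → ∃! x : ℝ, M.IsBestResponse Pc i r x) ∧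
        (∑ k ∈ Finset.univ.erase i, r k = 0 → ¬ ∃ x : ℝ, M.IsBestResponse Pc i r x)) ∧
      -- `H + Hᵀ` is strictly negative definite
      (∀ r : Fin N → ℝ, (∀ k, 0 ≤ r k) → 0 < ∑ k, r k →
        (∀ i, r i ≤ ∑ k ∈ Finset.univ.erase i, r k) →
        (∀ i, ContDiffAt ℝ 2 (M.workerUtility Pc i) r) ∧
        (-(M.pseudoHessian Pc r + (M.pseudoHessian Pc r).transpose)).PosDef) ∧
      -- existence and uniqueness of the Nash equilibrium
      (∃! r : Fin N → ℝ, M.IsNashEquilibrium Pc r) ∧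
      -- at equilibrium, a worker without positive utility does not participate
      (∀ r : Fin N → ℝ, M.IsNashEquilibrium Pc r →
        ∀ i, M.workerUtility Pc i r ≤ 0 → r i = 0)) ∧
    -- the Stackelberg equilibria are obtained by optimizing the total charging power
    (∃ rne : ℝ → Fin N → ℝ,
      (∀ Pc : ℝ, 0 ≤ Pc → ∀ r : Fin N → ℝ, M.IsNashEquilibrium Pc r ↔ r = rne Pc) ∧
      (∃ Pc : ℝ, 0 ≤ Pc ∧
        IsMaxOn (fun P : ℝ => M.platformUtility P (rne P)) (Set.Ici 0) Pc) ∧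
      (∀ (Pc : ℝ) (r : Fin N → ℝ), M.IsStackelbergEquilibrium Pc r ↔
        0 ≤ Pc ∧ IsMaxOn (fun P : ℝ => M.platformUtility P (rne P)) (Set.Ici 0) Pc ∧
          r = rne Pc)) := by
  have hU : ∀ (Pc : ℝ) (i : Fin N) (r : Fin N → ℝ),
      (fun t : ℝ => M.workerUtility Pc i (Function.update r i t))
        = M.ownUtility Pc i (∑ k ∈ Finset.univ.erase i, r k) := fun Pc i r =>
    funext (M.workerUtility_update Pc i r)
  refine ⟨fun Pc hP => ⟨fun i r hr => ?_, fun i r _ => ⟨fun hs => ?_, fun hs => ?_⟩,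
    fun r hr0 hr _ => ⟨fun i => M.contDiffAt_workerUtility Pc i hr.ne',
      M.posDef_neg_pseudoHessian_add_transpose hP hr0 hr⟩,
    M.existsUnique_isNashEquilibrium hN hP.le,
    fun r h i hu => h.eq_zero_of_workerUtility_nonpos hP hu⟩, ?_⟩
  · rw [hU]
    exact M.strictConcaveOn_ownUtility hP.le i (Finset.sum_nonneg fun k _ => hr k)
  · simp only [Crowdsourcing.Market.IsBestResponse, M.workerUtility_update]
    exact M.existsUnique_isMaxOn_ownUtility hP i hs
  · simp only [Crowdsourcing.Market.IsBestResponse, M.workerUtility_update, hs]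
    exact M.not_exists_isMaxOn_ownUtility_zero hP i
  · choose! rne hne huniq using fun (Pc : ℝ) (hP : 0 ≤ Pc) =>
      M.existsUnique_isNashEquilibrium hN hP
    have hiff : ∀ Pc : ℝ, 0 ≤ Pc → ∀ r : Fin N → ℝ, M.IsNashEquilibrium Pc r ↔ r = rne Pc :=
      fun Pc hP r => ⟨huniq Pc hP r, fun h => h ▸ hne Pc hP⟩
    have hS : ∀ (Pc : ℝ) (r : Fin N → ℝ), M.IsStackelbergEquilibrium Pc r ↔
        0 ≤ Pc ∧ IsMaxOn (fun P : ℝ => M.platformUtility P (rne P)) (Set.Ici 0) Pc ∧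
          r = rne Pc := by
      refine fun Pc r => ⟨fun ⟨hP, hr, hmax⟩ => ?_, fun ⟨hP, hmax, hr⟩ => ?_⟩
      · obtain rfl := (hiff Pc hP r).1 hr
        exact ⟨hP, fun P' hP' => hmax P' _ hP' (hne P' hP'), rfl⟩
      · subst hr
        refine ⟨hP, hne Pc hP, fun P' r' hP' hr' => ?_⟩
        obtain rfl := (hiff P' hP' r').1 hr'
        exact hmax hP'
    obtain ⟨Pc, r, h⟩ := M.exists_isStackelbergEquilibrium hN
    exact ⟨rne, hiff, ⟨Pc, h.1, ((hS Pc r).1 h).2.1⟩, hS⟩
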